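/- Let $G$ be a (finite dimensional, second countable) real Lie group with Lie algebra $\mathfrak g=T_1G$, let $\mathbf H$ be a complex Hilbert space, and let $\rho:G\to U(\mathbf H)$ be a unitary representation such that $g\mapsto\rho(g)x$ is continuous for every $x\in\mathbf H$. The bracket of $\mathfrak g$ is the one induced by right invariant vector fields (the negative of the one induced by left invariant fields), so that the fundamental vector field mapping of a left action is a homomorphism into the vector fields. Let $\mathbf H_\infty\subset\mathbf H$ be the space of smooth vectors, i.e. of all $x$ such that $g\mapsto\rho(g)x$ is smooth, with the Fréchet topology induced by the embedding $\mathbf H_\infty\to C^\infty(G,\mathbf H)$, $x\mapsto(g\mapsto\rho(g)x)$, where $C^\infty(G,\mathbf H)$ carries the topology of uniform convergence on compact sets of all derivatives separately. A mapping between (products of) such spaces or $\mathbb R$ is called smooth if it maps smooth curves to smooth curves. Let $\omega(x,y)=\operatorname{Im}\langle x,y\rangle$ for $x,y\in\mathbf H_\infty$, where $\langle\cdot,\cdot\rangle$ is complex linear in the first variable. For $X\in\mathfrak g$ and $x\in\mathbf H_\infty$ let $\rho'(X)(x)\in\mathbf H_\infty$ be the derivative at $1\in G$ in direction $X$ of $g\mapsto\rho(g)x$.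 Let $C^\infty_*(\mathbf H_\infty,\mathbb R)$ be the space of all smooth functions $f:\mathbf H_\infty\to\mathbb R$ such that for every $k\ge1$ and all $x,y_2,\dots,y_k\in\mathbf H_\infty$ the functional $d^kf(x)(\cdot,y_2,\dots,y_k)$ equals $\omega(\Phi_k(x,y_2,\dots,y_k),\cdot)$ for a (unique) $\Phi_k(x,y_2,\dots,y_k)\in\mathbf H_\infty$, and such that each mapping $\Phi_k:\mathbf H_\infty^k\to\mathbf H_\infty$ is smooth. For such $f$ the gradient $\operatorname{grad}^\omega f:\mathbf H_\infty\to\mathbf H_\infty$ is given by $df(x)y=\omega(\operatorname{grad}^\omega f(x),y)$, and the Poisson bracket by $\{f,h\}=\omega(\operatorname{grad}^\omega h,\operatorname{grad}^\omega f)=dh(\operatorname{grad}^\omega f)$. **Lemma 2.11.** For $X\in\mathfrak g$ put $\sigma(X)(x)=\tfrac12\,\omega(\rho'(X)(x),x)$, $x\in\mathbf H_\infty$. Then $\sigma(X)\in C^\infty_*(\mathbf H_\infty,\mathbb R)$ for all $X\in\mathfrak g$, and $\sigma:\mathfrak g\to C^\infty_*(\mathbf H_\infty,\mathbb R)$ is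 a Lie algebra homomorphism, i.e. $\sigma$ is $\mathbb R$-linear and $\sigma([X,Y])=\{\sigma(X),\sigma(Y)\}$ for all $X,Y\in\mathfrak g$. Moreover $\operatorname{grad}^\omega\sigma(X)=\rho'(X)$ for all $X\in\mathfrak g$. Finally $\sigma$ is $G$-equivariant: $\sigma(X)\circ\rho(g)=\sigma(\operatorname{Ad}(g^{-1})X)$ for all $g\in G$ and $X\in\mathfrak g$, where $\operatorname{Ad}(g)$ is the derivative at $1$ of $h\mapsto ghg^{-1}$. -/

import Mathlib

open scoped Manifold ContDiff Topology UniformConvergence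

noncomputable section

namespace UnitaryMoment

/-! ### Smooth curves and smooth mappings on topological real vector spaces -/

section Calculus

variable {V W : Type*} [AddCommGroup V] [Module ℝ V] [TopologicalSpace V]
  [AddCommGroup W] [Module ℝ W] [TopologicalSpace W]

/-- A curve is smooth if all its iterated derivatives exist and are continuous;
`d n` is the `n`-th derivative. -/
def IsSmoothCurve (c : ℝ → V) : Prop :=
  ∃ d : ℕ → ℝ → V, d 0 = c ∧ ∀ n : ℕ, Continuous (d n) ∧
    ∀ t : ℝ, Filter.Tendsto (fun s : ℝ => s⁻¹ • (d n (t + s) - d n t)) (𝓝[≠] 0) (𝓝 (d (n + 1) t))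

/-- A mapping is smooth if it maps smooth curves to smooth curves. -/
def IsSmoothMap (f : V → W) : Prop :=
  ∀ c : ℝ → V, IsSmoothCurve c → IsSmoothCurve (fun t => f (c t))

/-- The iterated derivative `dᵏf(x)(y₀, …, yₖ₋₁)` of a real function, as an iterated directional
derivative: `dᵏ⁺¹f(x)(y₀, y₁, …, yₖ)` is the derivative at `x` in direction `y₀` of
`z ↦ dᵏf(z)(y₁, …, yₖ)`. -/
def iterDirDeriv (f : V → ℝ) : (k : ℕ) → V → (Fin k → V) → ℝ
  | 0, x, _ => f x
  | k + 1, x, y => deriv (fun t : ℝ => iterDirDeriv f k (x + t • y 0) (Fin.tail y)) 0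

/-- The derivative `df(x)y = lim_{t → 0} (f(x + ty) - f(x)) / t`. -/
def dirDeriv (f : V → ℝ) (x y : V) : ℝ := deriv (fun t : ℝ => f (x + t • y)) 0

end Calculus

theorem iterDirDeriv_one {V : Type*} [AddCommGroup V] [Module ℝ V] (f : V → ℝ) (x : V)
    (y : Fin 1 → V) : iterDirDeriv f 1 x y = dirDeriv f x (y 0) := rfl

/-! ### Lie groups -/

section LieGroup

variable {E : Type*} [NormedAddCommGroup E] [NormedSpace ℝ E]
  {G : Type*} [TopologicalSpace G] [ChartedSpace E G] [Group G]

/-- The right invariant vector field on `G` with value `X` at the unit element. -/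
def rightInvariantField (X : GroupLieAlgebra 𝓘(ℝ, E) G) (g : G) : TangentSpace 𝓘(ℝ, E) g :=
  (mfderiv 𝓘(ℝ, E) 𝓘(ℝ, E) (fun h : G => h * g) 1 X : E)

/-- The Lie bracket on `𝔤 = T₁G` given by the Lie bracket of right invariant vector fields. This is
the bracket for which the fundamental vector field mapping of a left action is a homomorphism into
the Lie algebra of vector fields with its usual bracket. -/
def rightBracket (X Y : GroupLieAlgebra 𝓘(ℝ, E) G) : GroupLieAlgebra 𝓘(ℝ, E) G :=
  VectorField.mlieBracket 𝓘(ℝ, E) (rightInvariantField X) (rightInvariantField Y) (1 : G)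

/-- The adjoint representation: `Ad g` is the tangent mapping at `1` of `h ↦ g h g⁻¹`. -/
def Ad (g : G) (X : GroupLieAlgebra 𝓘(ℝ, E) G) : GroupLieAlgebra 𝓘(ℝ, E) G :=
  (mfderiv 𝓘(ℝ, E) 𝓘(ℝ, E) (fun h : G => g * h * g⁻¹) 1 X : E)

end LieGroup

/-! ### The compact `C^∞`-topology -/

section Topology

variable {E : Type*} [NormedAddCommGroup E] [NormedSpace ℝ E]
  {M : Type*} [TopologicalSpace M] [ChartedSpace E M]
  {H : Type*} [NormedAddCommGroup H] [NormedSpace ℝ H]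

/-- The compact `C^∞`-topology on `C^∞(M, H)`: uniform convergence on compact subsets of (chart
domains of) `M` of all derivatives (in charts) separately. -/
abbrev compactSmoothTopology : TopologicalSpace C^∞⟮𝓘(ℝ, E), M; 𝓘(ℝ, H), H⟯ :=
  ⨅ (p : M) (k : ℕ), TopologicalSpace.induced
    (fun f => UniformOnFun.ofFun {K : Set E | IsCompact K ∧ K ⊆ (chartAt E p).target}
      (iteratedFDeriv ℝ k (fun u : E => f ((chartAt E p).symm u))))
    inferInstance

end Topology

/-! ### Smooth vectors of a unitary representation -/

section Representation

variable (E : Type*) [NormedAddCommGroup E] [NormedSpace ℝ E]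
  {G : Type*} [TopologicalSpace G] [ChartedSpace E G] [Group G]
  {H : Type*} [NormedAddCommGroup H] [InnerProductSpace ℂ H]

/-- The subspace of smooth vectors: all `x` such that `g ↦ ρ(g)x` is smooth. -/
def smoothVectors (ρ : G →* (H ≃ₗᵢ[ℂ] H)) : Submodule ℂ H where
  carrier := {x | ContMDiff 𝓘(ℝ, E) 𝓘(ℝ, H) ∞ (fun g : G => ρ g x)}
  add_mem' {x y} hx hy := by
    have hx' : ContMDiff 𝓘(ℝ, E) 𝓘(ℝ, H) ∞ (fun g : G => ρ g x) := hx
    have hy' : ContMDiff 𝓘(ℝ, E) 𝓘(ℝ, H) ∞ (fun g : G => ρ g y) := hy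
    change ContMDiff 𝓘(ℝ, E) 𝓘(ℝ, H) ∞ (fun g : G => ρ g (x + y))
    simp only [map_add]
    exact hx'.add hy'
  zero_mem' := by
    change ContMDiff 𝓘(ℝ, E) 𝓘(ℝ, H) ∞ (fun g : G => ρ g 0)
    simp only [map_zero]
    exact contMDiff_const
  smul_mem' a x hx := by
    have hx' : ContMDiff 𝓘(ℝ, E) 𝓘(ℝ, H) ∞ (fun g : G => ρ g x) := hx
    have ha : ContDiff ℝ ∞ (fun v : H => a • v) := contDiff_const_smul a
    change ContMDiff 𝓘(ℝ, E) 𝓘(ℝ, H) ∞ (fun g : G => ρ g (a • x))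
    simp only [map_smul]
    exact ha.contMDiff.comp hx'

/-- The space `H_∞` of smooth vectors, as a type of its own: it carries the Fréchet topology below
and not the topology of a subspace of `H`. -/
def SmoothVector (ρ : G →* (H ≃ₗᵢ[ℂ] H)) : Type _ := ↥(smoothVectors E ρ)

variable {E}
variable {ρ : G →* (H ≃ₗᵢ[ℂ] H)}

instance : AddCommGroup (SmoothVector E ρ) := inferInstanceAs (AddCommGroup ↥(smoothVectors E ρ))

instance : Module ℂ (SmoothVector E ρ) := inferInstanceAs (Module ℂ ↥(smoothVectors E ρ))

namespace SmoothVector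

/-- The inclusion of `H_∞` into `H`. -/
def incl : SmoothVector E ρ →ₗ[ℂ] H := (smoothVectors E ρ).subtype

theorem contMDiff_orbit (x : SmoothVector E ρ) :
    ContMDiff 𝓘(ℝ, E) 𝓘(ℝ, H) ∞ (fun g : G => ρ g (incl x)) := x.2

/-- The embedding `j : H_∞ → C^∞(G, H)`, `j(x)(g) = ρ(g)x`. -/
def orbitMap (x : SmoothVector E ρ) : C^∞⟮𝓘(ℝ, E), G; 𝓘(ℝ, H), H⟯ :=
  ⟨fun g => ρ g (incl x), contMDiff_orbit x⟩

end SmoothVector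

open SmoothVector

/-- The topology of `H_∞`, induced from the compact `C^∞`-topology by `j`. -/
instance : TopologicalSpace (SmoothVector E ρ) :=
  TopologicalSpace.induced orbitMap compactSmoothTopology

/-- The symplectic form `ω = Im ⟨ , ⟩` on `H_∞`, where `⟨ , ⟩` is complex linear in the *first*
variable (Mathlib's inner product is linear in the second one), so `Re⟨x, y⟩ = ω(ix, y)`. -/
def omega (x y : SmoothVector E ρ) : ℝ := (inner ℂ (incl y) (incl x)).im

theorem omega_I_smul (x y : SmoothVector E ρ) :
    omega (Complex.I • x) y = (inner ℂ (incl y) (incl x)).re := by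
  simp [omega]

/-- `ω` is (weakly) non degenerate, hence gradients below are unique. -/
theorem eq_of_omega_eq {v w : SmoothVector E ρ} (h : ∀ y, omega v y = omega w y) : v = w := by
  have h1 := h (Complex.I • (v - w))
  have h2 : inner ℂ (incl (v - w)) (incl (v - w)) = 0 := by
    have : (inner ℂ (incl (v - w)) (incl (v - w))).re = 0 := by
      simp only [omega, map_smul, inner_smul_left, map_sub, inner_sub_left, inner_sub_right,
        Complex.conj_I, Complex.mul_im, Complex.sub_re, Complex.sub_im, Complex.neg_re,
        Complex.neg_im, Complex.I_re, Complex.I_im] at h1 ⊢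
      linarith
    apply Complex.ext this
    simpa using inner_self_im (𝕜 := ℂ) (incl (v - w))
  have h3 : (incl (v - w) : H) = 0 := inner_self_eq_zero.mp h2
  have h4 : v - w = 0 := Subtype.ext h3
  exact sub_eq_zero.mp h4

/-- The space `C^∞_*(H_∞, ℝ)`: all smooth functions `f` such that every
`dᵏ⁺¹f(x)( , y₁, …, yₖ)` lies in the smooth dual `ω(H_∞, )`, and such that its inverse image `Φ`
under `v ↦ ω(v, )` depends smoothly on `(x, y₁, …, yₖ)`. -/
def smoothStar (ρ : G →* (H ≃ₗᵢ[ℂ] H)) : Set (SmoothVector E ρ → ℝ) :=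
  {f | IsSmoothMap f ∧ ∀ k : ℕ,
    ∃ Φ : SmoothVector E ρ × (Fin k → SmoothVector E ρ) → SmoothVector E ρ, IsSmoothMap Φ ∧
      ∀ (x : SmoothVector E ρ) (y : Fin k → SmoothVector E ρ) (v : SmoothVector E ρ),
        iterDirDeriv f (k + 1) x (Fin.cons v y) = omega (Φ (x, y)) v}

open Classical in
/-- The symplectic gradient: `grad f (x)` is the unique vector with
`df(x)y = ω(grad f (x), y)` for all `y` (and `0` if there is no such vector, which does not occur
for `f` in `smoothStar ρ`). -/
def grad (f : SmoothVector E ρ → ℝ) (x : SmoothVector E ρ) : SmoothVector E ρ :=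
  if h : ∃ v, ∀ y, dirDeriv f x y = omega v y then h.choose else 0

theorem dirDeriv_eq_omega_grad {f : SmoothVector E ρ → ℝ} (hf : f ∈ smoothStar ρ)
    (x y : SmoothVector E ρ) : dirDeriv f x y = omega (grad f x) y := by
  obtain ⟨Φ, -, hΦ⟩ := hf.2 0
  have h : ∃ v, ∀ y, dirDeriv f x y = omega v y :=
    ⟨Φ (x, Fin.elim0), fun y => by rw [← hΦ x Fin.elim0 y, iterDirDeriv_one]; rfl⟩
  rw [grad, dif_pos h]
  exact h.choose_spec y

/-- The Poisson bracket `{f, g} = ω(grad g, grad f) = dg(grad f)`. -/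
def poisson (f g : SmoothVector E ρ → ℝ) (x : SmoothVector E ρ) : ℝ :=
  omega (grad g x) (grad f x)

/-! ### The representation on `H_∞` and its infinitesimal version -/

variable [LieGroup 𝓘(ℝ, E) ∞ G]

/-- The restriction of `ρ(g)` to the invariant subspace `H_∞`. -/
def act (ρ : G →* (H ≃ₗᵢ[ℂ] H)) (g : G) (x : SmoothVector E ρ) : SmoothVector E ρ :=
  ⟨ρ g (incl x), by
    have h := (contMDiff_orbit x).comp (contMDiff_mul_right (I := 𝓘(ℝ, E)) (n := ∞) (a := g))
    have e : (fun g' : G => ρ g' (ρ g (incl x))) =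
        (fun g' : G => ρ g' (incl x)) ∘ (fun g' => g' * g) := by
      funext g'
      simp
    change ContMDiff 𝓘(ℝ, E) 𝓘(ℝ, H) ∞ (fun g' : G => ρ g' (ρ g (incl x)))
    rw [e]
    exact h⟩

/-- The derivative at `1` of the orbit mapping `g ↦ ρ(g)x` is again a smooth vector. -/
theorem mfderiv_orbit_mem (X : GroupLieAlgebra 𝓘(ℝ, E) G) (x : SmoothVector E ρ) :
    (mfderiv 𝓘(ℝ, E) 𝓘(ℝ, H) (fun g : G => ρ g (incl x)) 1 X : H) ∈ smoothVectors E ρ := by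
  set f : G → H := fun g => ρ g (incl x) with hf
  have hfs : ContMDiff 𝓘(ℝ, E) 𝓘(ℝ, H) ∞ f := contMDiff_orbit x
  have key : ∀ g : G, (ρ g (mfderiv 𝓘(ℝ, E) 𝓘(ℝ, H) f 1 X : H) : H) =
      (mfderiv 𝓘(ℝ, E) 𝓘(ℝ, H) (fun h : G => f (g * h)) 1 X : H) := by
    intro g
    let L : H →L[ℝ] H :=
      (((ρ g).toContinuousLinearEquiv : H ≃L[ℂ] H) : H →L[ℂ] H).restrictScalars ℝ
    have e : (fun h : G => f (g * h)) = L ∘ f := by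
      funext h
      simp [hf, L]
    have h1 : HasMFDerivAt 𝓘(ℝ, E) 𝓘(ℝ, H) f 1 (mfderiv 𝓘(ℝ, E) 𝓘(ℝ, H) f 1) :=
      ((hfs 1).mdifferentiableAt (by simp)).hasMFDerivAt
    have h2 := (L.hasMFDerivAt (x := f 1)).comp (1 : G) h1
    rw [e, h2.mfderiv]
    rfl
  change ContMDiff 𝓘(ℝ, E) 𝓘(ℝ, H) ∞
    (fun g : G => ρ g (mfderiv 𝓘(ℝ, E) 𝓘(ℝ, H) f 1 X : H))
  simp only [key]
  intro g₀
  have hF : ContMDiffAt (𝓘(ℝ, E).prod 𝓘(ℝ, E)) 𝓘(ℝ, H) ∞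
      (Function.uncurry (fun g h : G => f (g * h))) (g₀, 1) :=
    (hfs.comp (contMDiff_mul 𝓘(ℝ, E) ∞)) (g₀, 1)
  have : IsManifold 𝓘(ℝ, E) 1 G := IsManifold.of_le (n := ∞) (by simp)
  have h3 := ContMDiffAt.mfderiv (m := ∞) (fun g h : G => f (g * h)) (fun _ => (1 : G)) hF
    contMDiffAt_const le_rfl
  have h4 : ContMDiffAt 𝓘(ℝ, E) 𝓘(ℝ, H) ∞ (fun g : G => _) g₀ :=
    h3.clm_apply (contMDiffAt_const (c := (show E from X)))
  refine h4.congr_of_eventuallyEq (Filter.Eventually.of_forall fun g => ?_)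
  have h5 := inTangentCoordinates_eq (I := 𝓘(ℝ, E)) (I' := 𝓘(ℝ, H)) (fun _ : G => (1 : G))
    (fun g : G => f (g * 1)) (fun g : G => mfderiv 𝓘(ℝ, E) 𝓘(ℝ, H) (fun h : G => f (g * h)) 1)
    (x₀ := g₀) (x := g) (mem_chart_source E (1 : G))
    (mem_chart_source H (f (g * 1)))
  have h6 : ∀ v : E, (tangentBundleCore 𝓘(ℝ, E) G).coordChange (achart E (1 : G))
      (achart E (1 : G)) 1 v = v := fun v =>
    (tangentBundleCore 𝓘(ℝ, E) G).coordChange_self _ _ (mem_chart_source E (1 : G)) v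
  have h7 := congrArg (fun T : E →L[ℝ] H => T X) h5
  refine Eq.trans ?_ h7.symm
  have h8 : ∀ w : H, (tangentBundleCore 𝓘(ℝ, H) H).coordChange (achart H (f (g * 1)))
      (achart H (f (g₀ * 1))) (f (g * 1)) w = w := fun w =>
    (tangentBundleCore 𝓘(ℝ, H) H).coordChange_self (achart H (f (g * 1))) _
      (mem_chart_source H (f (g * 1))) w
  exact ((h8 _).trans (congrArg
    (fun v : E => (mfderiv 𝓘(ℝ, E) 𝓘(ℝ, H) (fun h : G => f (g * h)) 1 v : H)) (h6 X))).symm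

/-- The infinitesimal representation `ρ'(X)(x) = T₁(g ↦ ρ(g)x)(X)`. -/
def infinitesimal (ρ : G →* (H ≃ₗᵢ[ℂ] H)) (X : GroupLieAlgebra 𝓘(ℝ, E) G)
    (x : SmoothVector E ρ) : SmoothVector E ρ :=
  ⟨(mfderiv 𝓘(ℝ, E) 𝓘(ℝ, H) (fun g : G => ρ g (incl x)) 1 X : H), mfderiv_orbit_mem X x⟩

/-- The mapping `σ(X)(x) = ½ ω(ρ'(X)x, x)`. -/
def sigma (ρ : G →* (H ≃ₗᵢ[ℂ] H)) (X : GroupLieAlgebra 𝓘(ℝ, E) G) (x : SmoothVector E ρ) : ℝ :=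
  (1 / 2) * omega (infinitesimal ρ X x) x

end Representation

end UnitaryMoment

end

namespace UnitaryMoment

/-! ### Smooth curves -/

section Curves

variable {V W : Type*} [AddCommGroup V] [Module ℝ V] [TopologicalSpace V]
  [AddCommGroup W] [Module ℝ W] [TopologicalSpace W]

/-! Unitarity makes `ρ'(X)` skew for `ω`, so `ω(ρ'(X)x, y)` is symmetric in `x, y` and `σ(X)` is a
quadratic form. Hence its first derivative is `ω(ρ'(X)x, ·)`, its second is constant in `x`, and the
rest vanish. This gives the gradient and reduces membership in `C^∞_*` essentially to continuity of
`ρ'(X)` on `H_∞` (`continuous_infinitesimal`): the orbit map of `ρ'(X)x` is the derivative of that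
of `x` along a left invariant field, so by Leibniz its derivatives up to order `k` are controlled by
those of `x` up to order `k + 1`.

For the bracket, a right invariant field turns the matrix coefficient `Im⟨y, ρ(g)x⟩` into minus the
one with `ρ'(X)y` in place of `y`. Since brackets of fields act on functions as commutators
(`vectorDeriv_apply_mlieBracket`), evaluation at `1` expresses `ω(ρ'([X,Y])x, y)` through `ρ'(X)`
and `ρ'(Y)`; the case `y = x` is the claim. Equivariance comes from `ρ(h)ρ(g) = ρ(g)ρ(g⁻¹hg)` and
the invariance of `ω`. -/

theorem IsSmoothCurve.map_linear {c : ℝ → V} (hc : IsSmoothCurve c) (L : V →ₗ[ℝ] W)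
    (hL : Continuous L) : IsSmoothCurve (fun t => L (c t)) := by
  obtain ⟨d, rfl, hd⟩ := hc
  refine ⟨fun n t => L (d n t), rfl, fun n => ⟨hL.comp (hd n).1, fun t => ?_⟩⟩
  simpa [Function.comp_def] using (hL.tendsto (d (n + 1) t)).comp ((hd n).2 t)

theorem isSmoothMap_linear (L : V →ₗ[ℝ] W) (hL : Continuous L) : IsSmoothMap L :=
  fun _ hc => hc.map_linear L hL

theorem isSmoothCurve_zero : IsSmoothCurve (fun _ => (0 : W)) :=
  ⟨fun _ _ => 0, rfl, fun _ => ⟨continuous_const, fun _ => by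
    simpa using tendsto_const_nhds⟩⟩

theorem isSmoothCurve_iff_contDiff {F : Type*} [NormedAddCommGroup F] [NormedSpace ℝ F]
    {c : ℝ → F} : IsSmoothCurve c ↔ ContDiff ℝ ∞ c := by
  constructor
  · rintro ⟨d, rfl, hd⟩
    have hderiv : ∀ n t, HasDerivAt (d n) (d (n + 1) t) t := fun n t =>
      hasDerivAt_iff_tendsto_slope_zero.2 ((hd n).2 t)
    -- All members of the sequence are treated at once, because raising the order by one passes from
    -- `d n` to `d (n + 1)`.
    have h : ∀ k n : ℕ, ContDiff ℝ k (d n) := by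
      intro k
      induction k with
      | zero => exact fun n => contDiff_zero.2 (hd n).1
      | succ k ih =>
        intro n
        push_cast
        refine contDiff_succ_iff_deriv.2 ⟨fun t => (hderiv n t).differentiableAt, by simp, ?_⟩
        rw [show deriv (d n) = d (n + 1) from funext fun t => (hderiv n t).deriv]
        exact ih _
    exact contDiff_infty.2 fun k => h k 0
  · intro hc
    refine ⟨fun n => iteratedDeriv n c, iteratedDeriv_zero, fun n =>
      ⟨hc.continuous_iteratedDeriv n (by exact_mod_cast le_top), fun t => ?_⟩⟩
    refine hasDerivAt_iff_tendsto_slope_zero.1 ?_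
    simp only [iteratedDeriv_succ]
    exact ((hc.differentiable_iteratedDeriv n (by exact_mod_cast ENat.natCast_lt_top n)) t).hasDerivAt

end Curves

/-! ### Chart expressions -/

section Charts

variable {E : Type*} [NormedAddCommGroup E] [NormedSpace ℝ E]
  {M : Type*} [TopologicalSpace M] [ChartedSpace E M]
  {F : Type*} [NormedAddCommGroup F] [NormedSpace ℝ F]

/-- The tangent space at `p` is `E` by way of the preferred chart at `p`, so the manifold derivative
is the Fréchet derivative of the chart expression. -/
theorem hasFDerivAt_comp_chartAt_symm {f : M → F} {p : M}
    (hf : MDifferentiableAt 𝓘(ℝ, E) 𝓘(ℝ, F) f p) :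
    HasFDerivAt (fun u => f ((chartAt E p).symm u))
      (show E →L[ℝ] F from mfderiv 𝓘(ℝ, E) 𝓘(ℝ, F) f p) (chartAt E p p) := by
  have h : HasFDerivWithinAt (fun u => f ((chartAt E p).symm u))
      (show E →L[ℝ] F from mfderiv 𝓘(ℝ, E) 𝓘(ℝ, F) f p) Set.univ (chartAt E p p) := by
    have h := hf.hasMFDerivAt.2
    rwa [ModelWithCorners.range_eq_univ] at h
  exact hasFDerivWithinAt_univ.1 h

theorem contDiffOn_comp_chartAt_symm [IsManifold 𝓘(ℝ, E) ∞ M] {f : M → F}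
    (hf : ContMDiff 𝓘(ℝ, E) 𝓘(ℝ, F) ∞ f) (p : M) :
    ContDiffOn ℝ ∞ (fun u => f ((chartAt E p).symm u)) (chartAt E p).target := by
  rw [← contMDiffOn_iff_contDiffOn]
  exact hf.comp_contMDiffOn (contMDiffOn_chart_symm (I := 𝓘(ℝ, E)) (n := ∞) (x := p))

end Charts

/-! ### Algebraic properties of the infinitesimal representation -/

section Representation

variable {E : Type*} [NormedAddCommGroup E] [NormedSpace ℝ E]
  {G : Type*} [TopologicalSpace G] [ChartedSpace E G] [Group G]
  {H : Type*} [NormedAddCommGroup H] [InnerProductSpace ℂ H]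
  {ρ : G →* (H ≃ₗᵢ[ℂ] H)}

open SmoothVector

theorem incl_injective : Function.Injective (incl : SmoothVector E ρ → H) :=
  Subtype.val_injective

theorem incl_real_smul (r : ℝ) (x : SmoothVector E ρ) : incl (r • x) = r • incl x := by
  rw [← Complex.coe_smul, map_smul, Complex.coe_smul]

/-- `v ↦ Im ⟨v, w⟩` as a continuous real linear functional on the Hilbert space. -/
noncomputable def imInner (w : H) : H →L[ℝ] ℝ :=
  Complex.imCLM.comp ((innerSL ℂ w).restrictScalars ℝ)

theorem imInner_apply (w v : H) : imInner w v = (inner ℂ w v).im := rfl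

theorem omega_eq_imInner (x y : SmoothVector E ρ) : omega x y = imInner (incl y) (incl x) := rfl

theorem omega_swap (x y : SmoothVector E ρ) : omega x y = -omega y x := by
  simp only [omega]
  rw [← inner_conj_symm, Complex.conj_im]

theorem omega_add_left (x y z : SmoothVector E ρ) : omega (x + y) z = omega x z + omega y z := by
  simp [omega_eq_imInner]

theorem omega_smul_left (r : ℝ) (x z : SmoothVector E ρ) : omega (r • x) z = r * omega x z := by
  rw [omega_eq_imInner, incl_real_smul, map_smul]; rfl

theorem omega_add_right (x y z : SmoothVector E ρ) : omega x (y + z) = omega x y + omega x z := by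
  rw [omega_swap, omega_add_left, omega_swap y, omega_swap z]; ring

theorem omega_smul_right (r : ℝ) (x z : SmoothVector E ρ) : omega x (r • z) = r * omega x z := by
  rw [omega_swap, omega_smul_left, omega_swap z]; ring

theorem mdifferentiable_orbit (x : SmoothVector E ρ) :
    MDifferentiable 𝓘(ℝ, E) 𝓘(ℝ, H) (fun g : G => ρ g (incl x)) :=
  (contMDiff_orbit x).mdifferentiable (by simp)

variable [LieGroup 𝓘(ℝ, E) ∞ G]

/-- One `D` serves all `X`: linearity of `ρ'` in `X` is linearity of `D`, and linearity in `x`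
follows from uniqueness of derivatives. -/
theorem hasFDerivAt_orbit (x : SmoothVector E ρ) :
    ∃ D : E →L[ℝ] H, HasFDerivAt (fun u : E => ρ ((chartAt E (1 : G)).symm u) (incl x)) D
      (chartAt E (1 : G) 1) ∧
      ∀ X : GroupLieAlgebra 𝓘(ℝ, E) G, incl (infinitesimal ρ X x) = D X :=
  ⟨_, hasFDerivAt_comp_chartAt_symm (mdifferentiable_orbit x 1), fun _ => rfl⟩

theorem infinitesimal_add (X : GroupLieAlgebra 𝓘(ℝ, E) G) (x y : SmoothVector E ρ) :
    infinitesimal ρ X (x + y) = infinitesimal ρ X x + infinitesimal ρ X y := by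
  obtain ⟨D₁, h₁, e₁⟩ := hasFDerivAt_orbit x
  obtain ⟨D₂, h₂, e₂⟩ := hasFDerivAt_orbit y
  obtain ⟨D, h, e⟩ := hasFDerivAt_orbit (x + y)
  apply incl_injective
  rw [e, map_add, e₁, e₂]
  simp only [map_add] at h
  rw [h.unique (h₁.add h₂)]
  rfl

theorem infinitesimal_smul (X : GroupLieAlgebra 𝓘(ℝ, E) G) (r : ℝ) (x : SmoothVector E ρ) :
    infinitesimal ρ X (r • x) = r • infinitesimal ρ X x := by
  obtain ⟨D₁, h₁, e₁⟩ := hasFDerivAt_orbit x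
  obtain ⟨D, h, e⟩ := hasFDerivAt_orbit (r • x)
  apply incl_injective
  rw [e, incl_real_smul, e₁]
  have hr : ∀ g : G, ρ g (incl (r • x)) = r • ρ g (incl x) := fun g => by
    rw [incl_real_smul, ← Complex.coe_smul, map_smul, Complex.coe_smul]
  simp only [hr] at h
  rw [h.unique (h₁.const_smul r)]
  rfl

theorem infinitesimal_add_left (X Y : GroupLieAlgebra 𝓘(ℝ, E) G) (x : SmoothVector E ρ) :
    infinitesimal ρ (X + Y) x = infinitesimal ρ X x + infinitesimal ρ Y x := by
  obtain ⟨D, -, e⟩ := hasFDerivAt_orbit x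
  apply incl_injective
  rw [map_add, e, e, e]
  exact map_add D X Y

theorem infinitesimal_smul_left (r : ℝ) (X : GroupLieAlgebra 𝓘(ℝ, E) G) (x : SmoothVector E ρ) :
    infinitesimal ρ (r • X) x = r • infinitesimal ρ X x := by
  obtain ⟨D, -, e⟩ := hasFDerivAt_orbit x
  apply incl_injective
  rw [incl_real_smul, e, e]
  exact map_smul D r X

variable (ρ) in
/-- `ρ'(X)` as a real linear map on the smooth vectors. -/
noncomputable def infinitesimalLinear (X : GroupLieAlgebra 𝓘(ℝ, E) G) :
    SmoothVector E ρ →ₗ[ℝ] SmoothVector E ρ where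
  toFun := infinitesimal ρ X
  map_add' := infinitesimal_add X
  map_smul' := infinitesimal_smul X

/-- `ρ'(X)` is skew Hermitian. -/
theorem inner_infinitesimal (X : GroupLieAlgebra 𝓘(ℝ, E) G) (x y : SmoothVector E ρ) :
    inner ℂ (incl x) (incl (infinitesimal ρ X y)) +
      inner ℂ (incl (infinitesimal ρ X x)) (incl y) = 0 := by
  obtain ⟨D₁, h₁, e₁⟩ := hasFDerivAt_orbit x
  obtain ⟨D₂, h₂, e₂⟩ := hasFDerivAt_orbit y
  -- By unitarity the inner product of the two orbits is constant, so this derivative is zero.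
  have h := h₁.inner ℂ h₂
  simp only [LinearIsometryEquiv.inner_map_map] at h
  have h0 := h.unique (hasFDerivAt_const _ _)
  have h1 := congrArg (fun T : E →L[ℝ] ℂ => T X) h0
  rw [e₁, e₂]
  rw [(chartAt E (1 : G)).left_inv (mem_chart_source E (1 : G)), map_one] at h1
  exact h1

theorem omega_infinitesimal (X : GroupLieAlgebra 𝓘(ℝ, E) G) (x y : SmoothVector E ρ) :
    omega (infinitesimal ρ X x) y = -omega x (infinitesimal ρ X y) := by
  have h := congrArg Complex.im (inner_infinitesimal X y x)
  simp only [Complex.add_im, Complex.zero_im] at h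
  simp only [omega]
  linarith

theorem omega_infinitesimal_comm (X : GroupLieAlgebra 𝓘(ℝ, E) G) (x y : SmoothVector E ρ) :
    omega (infinitesimal ρ X x) y = omega (infinitesimal ρ X y) x := by
  rw [omega_infinitesimal, omega_swap x, neg_neg]

/-! ### Derivatives of `σ` -/

theorem iterDirDeriv_sigma_one (X : GroupLieAlgebra 𝓘(ℝ, E) G) (x : SmoothVector E ρ)
    (y : Fin 1 → SmoothVector E ρ) :
    iterDirDeriv (sigma ρ X) 1 x y = omega (infinitesimal ρ X x) (y 0) := by
  -- Symmetry of the form merges the two mixed terms, which cancels the factor `1/2`.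
  have h : (fun t : ℝ => sigma ρ X (x + t • y 0)) = fun t : ℝ => sigma ρ X x +
      (t * omega (infinitesimal ρ X x) (y 0) + t ^ 2 * sigma ρ X (y 0)) := by
    funext t
    simp only [sigma, infinitesimal_add, infinitesimal_smul, omega_add_left, omega_add_right,
      omega_smul_left, omega_smul_right]
    rw [omega_infinitesimal_comm X (y 0) x]
    ring
  have hd : HasDerivAt (fun t : ℝ => sigma ρ X (x + t • y 0))
      (omega (infinitesimal ρ X x) (y 0)) 0 := by
    rw [h]
    simpa using (((hasDerivAt_id (0 : ℝ)).mul_const (omega (infinitesimal ρ X x) (y 0))).add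
      (((hasDerivAt_id (0 : ℝ)).pow 2).mul_const (sigma ρ X (y 0)))).const_add (sigma ρ X x)
  exact hd.deriv

theorem iterDirDeriv_sigma_two (X : GroupLieAlgebra 𝓘(ℝ, E) G) (x : SmoothVector E ρ)
    (y : Fin 2 → SmoothVector E ρ) :
    iterDirDeriv (sigma ρ X) 2 x y = omega (infinitesimal ρ X (y 1)) (y 0) := by
  change deriv (fun t : ℝ => iterDirDeriv (sigma ρ X) 1 (x + t • y 0) (Fin.tail y)) 0 = _
  simp only [iterDirDeriv_sigma_one, infinitesimal_add, infinitesimal_smul, omega_add_left,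
    omega_smul_left]
  have hd := ((hasDerivAt_id (0 : ℝ)).mul_const
    (omega (infinitesimal ρ X (y 0)) (Fin.tail y 0))).const_add
      (omega (infinitesimal ρ X x) (Fin.tail y 0))
  refine hd.deriv.trans ?_
  rw [one_mul, omega_infinitesimal_comm]
  rfl

theorem iterDirDeriv_sigma_of_three_le (X : GroupLieAlgebra 𝓘(ℝ, E) G) (k : ℕ)
    (x : SmoothVector E ρ) (y : Fin (k + 3) → SmoothVector E ρ) :
    iterDirDeriv (sigma ρ X) (k + 3) x y = 0 := by
  induction k generalizing x with
  | zero =>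
    change deriv (fun t : ℝ => iterDirDeriv (sigma ρ X) 2 (x + t • y 0) (Fin.tail y)) 0 = _
    simp only [iterDirDeriv_sigma_two, deriv_const]
  | succ k ih =>
    change deriv (fun t : ℝ => iterDirDeriv (sigma ρ X) (k + 3) (x + t • y 0) (Fin.tail y)) 0 = _
    simp only [ih, deriv_const]

theorem dirDeriv_sigma (X : GroupLieAlgebra 𝓘(ℝ, E) G) (x y : SmoothVector E ρ) :
    dirDeriv (sigma ρ X) x y = omega (infinitesimal ρ X x) y :=
  iterDirDeriv_sigma_one X x fun _ => y

theorem grad_sigma (X : GroupLieAlgebra 𝓘(ℝ, E) G) :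
    grad (sigma ρ X) = infinitesimal ρ X := by
  funext x
  have h : ∃ v, ∀ y, dirDeriv (sigma ρ X) x y = omega v y := ⟨_, dirDeriv_sigma X x⟩
  rw [grad, dif_pos h]
  exact eq_of_omega_eq fun y => by rw [← h.choose_spec y, dirDeriv_sigma]

/-! ### Equivariance -/

theorem infinitesimal_act (g : G) (X : GroupLieAlgebra 𝓘(ℝ, E) G) (x : SmoothVector E ρ) :
    infinitesimal ρ X (act ρ g x) = act ρ g (infinitesimal ρ (Ad g⁻¹ X) x) := by
  apply incl_injective
  let c : G → G := fun h => g⁻¹ * h * g⁻¹⁻¹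
  let L : H →L[ℝ] H :=
    (((ρ g).toContinuousLinearEquiv : H ≃L[ℂ] H) : H →L[ℂ] H).restrictScalars ℝ
  have hc : MDifferentiableAt 𝓘(ℝ, E) 𝓘(ℝ, E) c 1 :=
    ((contMDiff_mul_right (I := 𝓘(ℝ, E)) (n := ∞) (a := g⁻¹⁻¹)).comp
      (contMDiff_mul_left (I := 𝓘(ℝ, E)) (n := ∞) (a := g⁻¹))).mdifferentiable (by simp) 1
  -- The base point `c 1` equals `1` only propositionally, so the derivative at `1` is transported
  -- along an equation.
  have hf : ∀ q : G, q = 1 → HasMFDerivAt 𝓘(ℝ, E) 𝓘(ℝ, H) (fun h : G => ρ h (incl x)) q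
      (show E →L[ℝ] H from mfderiv 𝓘(ℝ, E) 𝓘(ℝ, H) (fun h : G => ρ h (incl x)) 1) := by
    rintro q rfl
    exact (mdifferentiable_orbit x _).hasMFDerivAt
  have h1 := (L.hasMFDerivAt (x := ρ (c 1) (incl x))).comp (1 : G)
    ((hf (c 1) (by simp [c])).comp (1 : G) hc.hasMFDerivAt)
  have e : (fun h : G => ρ h (incl (act ρ g x))) = L ∘ (fun h : G => ρ h (incl x)) ∘ c := by
    funext h
    change ρ h (ρ g (incl x)) = ρ g (ρ (g⁻¹ * h * g⁻¹⁻¹) (incl x))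
    have hmul : ∀ (a b : G) (v : H), ρ (a * b) v = ρ a (ρ b v) := fun a b v => by
      rw [map_mul]; rfl
    rw [← hmul, ← hmul]
    congr 2
    group
  change (mfderiv 𝓘(ℝ, E) 𝓘(ℝ, H) (fun h : G => ρ h (incl (act ρ g x))) 1 X : H) = _
  rw [e, h1.mfderiv]
  rfl

theorem omega_act (g : G) (x y : SmoothVector E ρ) : omega (act ρ g x) (act ρ g y) = omega x y := by
  simp only [omega]
  exact congrArg Complex.im ((ρ g).inner_map_map _ _)

theorem sigma_comp_act (g : G) (X : GroupLieAlgebra 𝓘(ℝ, E) G) :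
    sigma ρ X ∘ act ρ g = sigma ρ (Ad g⁻¹ X) := by
  funext x
  simp only [Function.comp_apply, sigma, infinitesimal_act, omega_act]

end Representation

end UnitaryMoment

namespace UnitaryMoment

/-! ### The Fréchet topology of `H_∞` and continuity of `ρ'(X)` -/

section Continuity

open SmoothVector

variable {E : Type*} [NormedAddCommGroup E] [NormedSpace ℝ E]
  {G : Type*} [TopologicalSpace G] [ChartedSpace E G] [Group G]
  {H : Type*} [NormedAddCommGroup H] [InnerProductSpace ℂ H]
  {ρ : G →* (H ≃ₗᵢ[ℂ] H)}

/-- The orbit mapping of a smooth vector, read in the preferred chart at `p`. -/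
def chartOrbit (p : G) (x : SmoothVector E ρ) (u : E) : H := ρ ((chartAt E p).symm u) (incl x)

theorem chartOrbit_sub (p : G) (x y : SmoothVector E ρ) :
    chartOrbit p (x - y) = chartOrbit p x - chartOrbit p y := by
  funext u
  simp [chartOrbit]

theorem tendstoUniformlyOn_iteratedFDeriv_chartOrbit (p : G) (k : ℕ) {K : Set E}
    (hK : IsCompact K) (hKt : K ⊆ (chartAt E p).target) (x₀ : SmoothVector E ρ) :
    TendstoUniformlyOn (fun x => iteratedFDeriv ℝ k (chartOrbit p x))
      (iteratedFDeriv ℝ k (chartOrbit p x₀)) (𝓝 x₀) K := by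
  have h1 : Continuous (fun x : SmoothVector E ρ =>
      UniformOnFun.ofFun {K : Set E | IsCompact K ∧ K ⊆ (chartAt E p).target}
        (iteratedFDeriv ℝ k (chartOrbit p x))) := by
    let : TopologicalSpace C^∞⟮𝓘(ℝ, E), G; 𝓘(ℝ, H), H⟯ := compactSmoothTopology
    refine Continuous.comp (g := fun f : C^∞⟮𝓘(ℝ, E), G; 𝓘(ℝ, H), H⟯ =>
      UniformOnFun.ofFun {K : Set E | IsCompact K ∧ K ⊆ (chartAt E p).target}
        (iteratedFDeriv ℝ k (fun u : E => f ((chartAt E p).symm u)))) (f := orbitMap)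
      ?_ continuous_induced_dom
    exact continuous_iInf_dom (i := p) (continuous_iInf_dom (i := k) continuous_induced_dom)
  exact UniformOnFun.tendsto_iff_tendstoUniformlyOn.1 (h1.tendsto x₀) K ⟨hK, hKt⟩

theorem continuous_smoothVector_of_tendstoUniformlyOn {Z : Type*} [TopologicalSpace Z]
    {f : Z → SmoothVector E ρ}
    (h : ∀ (p : G) (k : ℕ) (K : Set E), IsCompact K → K ⊆ (chartAt E p).target → ∀ z₀ : Z,
      TendstoUniformlyOn (fun z => iteratedFDeriv ℝ k (chartOrbit p (f z)))
        (iteratedFDeriv ℝ k (chartOrbit p (f z₀))) (𝓝 z₀) K) :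
    Continuous f := by
  refine continuous_induced_rng.2 (continuous_iInf_rng.2 fun p => continuous_iInf_rng.2 fun k =>
    continuous_induced_rng.2 (continuous_iff_continuousAt.2 fun z₀ => ?_))
  exact UniformOnFun.tendsto_iff_tendstoUniformlyOn.2 fun K hK => h p k K hK.1 hK.2 z₀

theorem continuous_incl : Continuous (incl : SmoothVector E ρ → H) := by
  refine continuous_iff_continuousAt.2 fun x₀ => ?_
  -- Order zero on the single point `1` of `G` already recovers `x = ρ(1)x`.
  have h := (tendstoUniformlyOn_iteratedFDeriv_chartOrbit (ρ := ρ) (1 : G) 0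
    (isCompact_singleton (x := chartAt E (1 : G) 1))
    (Set.singleton_subset_iff.2 (mem_chart_target E (1 : G))) x₀).tendsto_at rfl
  have h2 := (ContinuousMultilinearMap.apply ℝ (fun _ : Fin 0 => E) H 0).continuous.tendsto _ |>.comp h
  simpa [Function.comp_def, chartOrbit, ContinuousAt,
    (chartAt E (1 : G)).left_inv (mem_chart_source E (1 : G))] using h2

variable [LieGroup 𝓘(ℝ, E) ∞ G]

theorem contDiffOn_chartOrbit (p : G) (x : SmoothVector E ρ) :
    ContDiffOn ℝ ∞ (chartOrbit p x) (chartAt E p).target :=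
  haveI : IsManifold 𝓘(ℝ, E) ∞ G := inferInstance
  contDiffOn_comp_chartAt_symm (contMDiff_orbit x) p

/-- The left invariant vector field with value `X` at the unit element, in the chart at `p`. -/
theorem exists_chart_leftInvariantField (ρ : G →* (H ≃ₗᵢ[ℂ] H)) (X : GroupLieAlgebra 𝓘(ℝ, E) G)
    (p : G) :
    ∃ V : E → E, ContDiffOn ℝ ∞ V (chartAt E p).target ∧
      ∀ x : SmoothVector E ρ, ∀ u ∈ (chartAt E p).target,
        chartOrbit p (infinitesimal ρ X x) u = fderiv ℝ (chartOrbit p x) u (V u) := by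
  have : IsManifold 𝓘(ℝ, E) ∞ G := inferInstance
  set φ := chartAt E p
  set ψ := chartAt E (1 : G)
  set w₀ := ψ 1
  have hψw : ψ.symm w₀ = 1 := ψ.left_inv (mem_chart_source E (1 : G))
  let m : E → E → E := fun u w => φ (φ.symm u * ψ.symm w)
  have hmul : ∀ u ∈ φ.target, ContMDiffAt 𝓘(ℝ, E × E) 𝓘(ℝ, E) ∞
      (fun q : E × E => φ.symm q.1 * ψ.symm q.2) (u, w₀) := by
    intro u hu
    refine ContMDiffAt.mul ?_ ?_
    · exact ContMDiffAt.comp (I' := 𝓘(ℝ, E)) (u, w₀)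
        ((contMDiffOn_chart_symm (I := 𝓘(ℝ, E)) (n := ∞) (x := p)).contMDiffAt
          (φ.open_target.mem_nhds hu)) contDiff_fst.contMDiff.contMDiffAt
    · exact ContMDiffAt.comp (I' := 𝓘(ℝ, E)) (u, w₀)
        ((contMDiffOn_chart_symm (I := 𝓘(ℝ, E)) (n := ∞) (x := (1 : G))).contMDiffAt
          (ψ.open_target.mem_nhds (mem_chart_target E (1 : G)))) contDiff_snd.contMDiff.contMDiffAt
  have hsrc : ∀ u ∈ φ.target, φ.symm u * ψ.symm w₀ ∈ φ.source := by
    intro u hu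
    rw [hψw, mul_one]
    exact φ.map_target hu
  have hm : ∀ u ∈ φ.target, ContDiffAt ℝ ∞ (Function.uncurry m) (u, w₀) := by
    intro u hu
    rw [← contMDiffAt_iff_contDiffAt]
    exact ContMDiffAt.comp (I' := 𝓘(ℝ, E)) (u, w₀)
      ((contMDiffOn_chart (I := 𝓘(ℝ, E)) (n := ∞) (x := p)).contMDiffAt
        (φ.open_source.mem_nhds (hsrc u hu))) (hmul u hu)
  -- The field is the partial derivative of multiplication, read in charts, in its second argument
  -- at `1`. It does not depend on `x`, which makes the later estimate uniform in `x`.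
  refine ⟨fun u => fderiv ℝ (m u) w₀ X, fun u hu => ?_, fun x u hu => ?_⟩
  · exact ((ContDiffAt.fderiv (hm u hu) contDiffAt_const le_rfl).clm_apply
      contDiffAt_const).contDiffWithinAt
  · obtain ⟨D, hD, hDX⟩ := hasFDerivAt_orbit (ρ := ρ) x
    have hmu : m u w₀ = u := by
      simp only [m, hψw, mul_one]
      exact φ.right_inv hu
    have hpair : HasFDerivAt (fun w : E => (u, w)) (ContinuousLinearMap.inr ℝ E E) w₀ :=
      hasFDerivAt_prodMk_right u w₀
    have hmd : DifferentiableAt ℝ (m u) w₀ :=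
      (((hm u hu).differentiableAt (by simp)).hasFDerivAt.comp w₀ hpair).differentiableAt
    have hF : HasFDerivAt (chartOrbit p x) (fderiv ℝ (chartOrbit p x) u) (m u w₀) := by
      rw [hmu]
      exact (((contDiffOn_chartOrbit p x).contDiffAt
        (φ.open_target.mem_nhds hu)).differentiableAt (by simp)).hasFDerivAt
    have h1 := hF.comp w₀ hmd.hasFDerivAt
    let L : H →L[ℝ] H := (((ρ (φ.symm u)).toContinuousLinearEquiv : H ≃L[ℂ] H) :
      H →L[ℂ] H).restrictScalars ℝ
    have h2 := L.hasFDerivAt.comp w₀ hD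
    have hnear : ∀ᶠ w in 𝓝 w₀, φ.symm u * ψ.symm w ∈ φ.source :=
      ((hmul u hu).continuousAt.comp hpair.continuousAt).eventually
        (φ.open_source.mem_nhds (hsrc u hu))
    -- This is `ρ(gh)x = ρ(g)ρ(h)x` in charts, valid while the product stays in the chart domain;
    -- both sides are differentiated in `h` at `1`.
    have heq : (chartOrbit p x ∘ m u) =ᶠ[𝓝 w₀]
        (L ∘ fun w : E => ρ (ψ.symm w) (incl x)) := by
      filter_upwards [hnear] with w hw
      simp only [Function.comp_apply, chartOrbit, m]
      rw [φ.left_inv hw, map_mul]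
      rfl
    have h3 := congrArg (fun T : E →L[ℝ] H => T X) (h1.unique (h2.congr_of_eventuallyEq heq))
    refine Eq.trans ?_ h3.symm
    rw [chartOrbit, hDX]
    rfl

/-- Leibniz rule for a derivative evaluated on a field. The loss of one order is harmless, since the
topology controls all orders. -/
theorem norm_iteratedFDeriv_chartOrbit_infinitesimal_le {X : GroupLieAlgebra 𝓘(ℝ, E) G} {p : G}
    {V : E → E} (hV : ContDiffOn ℝ ∞ V (chartAt E p).target) {x : SmoothVector E ρ}
    (hx : ∀ u ∈ (chartAt E p).target,
      chartOrbit p (infinitesimal ρ X x) u = fderiv ℝ (chartOrbit p x) u (V u))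
    (k : ℕ) {u : E} (hu : u ∈ (chartAt E p).target) :
    ‖iteratedFDeriv ℝ k (chartOrbit p (infinitesimal ρ X x)) u‖ ≤
      ∑ i ∈ Finset.range (k + 1), (k.choose i : ℝ) *
        ‖iteratedFDeriv ℝ (i + 1) (chartOrbit p x) u‖ * ‖iteratedFDeriv ℝ (k - i) V u‖ := by
  have ho : IsOpen (chartAt E p).target := (chartAt E p).open_target
  have hF : ContDiffOn ℝ ∞ (fderiv ℝ (chartOrbit p x)) (chartAt E p).target :=
    (contDiffOn_chartOrbit p x).fderiv_of_isOpen ho le_rfl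
  have h := norm_iteratedFDerivWithin_clm_apply (n := k) hF hV ho.uniqueDiffOn hu
    (by exact_mod_cast le_top)
  rw [← iteratedFDerivWithin_congr hx hu, iteratedFDerivWithin_of_isOpen k ho hu] at h
  refine h.trans (le_of_eq (Finset.sum_congr rfl fun i _ => ?_))
  rw [iteratedFDerivWithin_of_isOpen _ ho hu, iteratedFDerivWithin_of_isOpen _ ho hu,
    norm_iteratedFDeriv_fderiv]

theorem continuous_infinitesimal (X : GroupLieAlgebra 𝓘(ℝ, E) G) :
    Continuous (infinitesimal ρ X) := by
  refine continuous_smoothVector_of_tendstoUniformlyOn fun p k K hK hKt x₀ => ?_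
  obtain ⟨V, hV, hVx⟩ := exists_chart_leftInvariantField ρ X p
  have ho : IsOpen (chartAt E p).target := (chartAt E p).open_target
  have hsub : ∀ (j : ℕ) (y z : SmoothVector E ρ), ∀ u ∈ K,
      iteratedFDeriv ℝ j (chartOrbit p (y - z)) u =
        iteratedFDeriv ℝ j (chartOrbit p y) u - iteratedFDeriv ℝ j (chartOrbit p z) u := by
    intro j y z u hu
    have hat : ∀ y : SmoothVector E ρ, ContDiffAt ℝ j (chartOrbit p y) u := fun y =>
      ((contDiffOn_chartOrbit p y).contDiffAt (ho.mem_nhds (hKt hu))).of_le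
        (by exact_mod_cast le_top)
    rw [chartOrbit_sub]
    exact iteratedFDeriv_sub_apply (hat y) (hat z)
  have hbound : ∀ j : ℕ, ∃ C, ∀ u ∈ K, ‖iteratedFDeriv ℝ j V u‖ ≤ C := fun j =>
    hK.exists_bound_of_continuousOn fun u hu =>
      (((hV.contDiffAt (ho.mem_nhds (hKt hu))).iteratedFDeriv_right (m := 0) (i := j)
        (by exact_mod_cast le_top)).continuousAt).continuousWithinAt
  choose C hC using hbound
  rw [Metric.tendstoUniformlyOn_iff]
  intro ε hε
  -- Absolute values are taken because nothing forces the bounds `C` to be nonnegative when `K` is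
  -- empty; dividing by `S + 1` also covers `S = 0`.
  set S : ℝ := ∑ i ∈ Finset.range (k + 1), (k.choose i : ℝ) * |C (k - i)| with hS
  have hS0 : 0 ≤ S := Finset.sum_nonneg fun i _ => by positivity
  have hδ : 0 < ε / (S + 1) := by positivity
  have hev : ∀ᶠ x in 𝓝 x₀, ∀ i ∈ Finset.range (k + 1), ∀ u ∈ K,
      ‖iteratedFDeriv ℝ (i + 1) (chartOrbit p (x₀ - x)) u‖ < ε / (S + 1) := by
    refine (Filter.eventually_all_finset _).2 fun i _ => ?_
    have h := Metric.tendstoUniformlyOn_iff.1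
      (tendstoUniformlyOn_iteratedFDeriv_chartOrbit p (i + 1) hK hKt x₀) _ hδ
    filter_upwards [h] with x hx u hu
    rw [hsub _ _ _ u hu, ← dist_eq_norm]
    exact hx u hu
  filter_upwards [hev] with x hx u hu
  have hlin : infinitesimal ρ X (x₀ - x) = infinitesimal ρ X x₀ - infinitesimal ρ X x :=
    map_sub (infinitesimalLinear ρ X) x₀ x
  rw [dist_eq_norm, ← hsub _ _ _ u hu, ← hlin]
  calc ‖iteratedFDeriv ℝ k (chartOrbit p (infinitesimal ρ X (x₀ - x))) u‖
      ≤ ∑ i ∈ Finset.range (k + 1), (k.choose i : ℝ) *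
          ‖iteratedFDeriv ℝ (i + 1) (chartOrbit p (x₀ - x)) u‖ * ‖iteratedFDeriv ℝ (k - i) V u‖ :=
        norm_iteratedFDeriv_chartOrbit_infinitesimal_le hV (hVx _) k (hKt hu)
    _ ≤ ∑ i ∈ Finset.range (k + 1), (k.choose i : ℝ) * (ε / (S + 1)) * |C (k - i)| := by
        refine Finset.sum_le_sum fun i hi => ?_
        gcongr
        · exact (hx i hi u hu).le
        · exact (hC _ u hu).trans (le_abs_self _)
    _ = S * (ε / (S + 1)) := by
        rw [hS, Finset.sum_mul]
        exact Finset.sum_congr rfl fun i _ => by ring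
    _ < ε := by
        rw [← mul_div_assoc, div_lt_iff₀ (by positivity)]
        nlinarith

/-! ### Smoothness of `σ` -/

/-- The inclusion of the smooth vectors as a real linear map. -/
noncomputable def inclReal : SmoothVector E ρ →ₗ[ℝ] H where
  toFun := incl
  map_add' := map_add incl
  map_smul' := incl_real_smul

/-- Along a smooth curve both entries of `ω` become smooth curves in `H`, where the inner product is
smooth. -/
theorem isSmoothMap_sigma (X : GroupLieAlgebra 𝓘(ℝ, E) G) : IsSmoothMap (sigma ρ X) := by
  intro c hc
  have h1 : ContDiff ℝ ∞ (fun t => incl (c t)) :=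
    isSmoothCurve_iff_contDiff.1 (hc.map_linear inclReal continuous_incl)
  have h2 : ContDiff ℝ ∞ (fun t => incl (infinitesimal ρ X (c t))) :=
    isSmoothCurve_iff_contDiff.1 ((hc.map_linear (infinitesimalLinear ρ X)
      (continuous_infinitesimal X)).map_linear inclReal continuous_incl)
  exact isSmoothCurve_iff_contDiff.2
    (contDiff_const.mul (Complex.imCLM.contDiff.comp (h1.inner ℂ h2)))

theorem sigma_mem_smoothStar (X : GroupLieAlgebra 𝓘(ℝ, E) G) : sigma ρ X ∈ smoothStar ρ := by
  refine ⟨isSmoothMap_sigma X, fun k => ?_⟩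
  -- Index `k` concerns the derivative of order `k + 1`: the representing vectors are `ρ'(X)x`, then
  -- `ρ'(X)` of the single remaining direction, then `0`.
  match k with
  | 0 =>
    refine ⟨_, isSmoothMap_linear ((infinitesimalLinear ρ X).comp (LinearMap.fst ℝ _ _))
      ((continuous_infinitesimal X).comp continuous_fst), fun x y v => ?_⟩
    rw [iterDirDeriv_sigma_one]
    rfl
  | 1 =>
    refine ⟨_, isSmoothMap_linear ((infinitesimalLinear ρ X).comp
      ((LinearMap.proj (0 : Fin 1)).comp (LinearMap.snd ℝ _ _)))
      ((continuous_infinitesimal X).comp ((continuous_apply 0).comp continuous_snd)),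
      fun x y v => ?_⟩
    rw [iterDirDeriv_sigma_two]
    rfl
  | k + 2 =>
    refine ⟨fun _ => 0, fun _ _ => isSmoothCurve_zero, fun x y v => ?_⟩
    rw [iterDirDeriv_sigma_of_three_le]
    simp [omega]

end Continuity

end UnitaryMoment

namespace UnitaryMoment

/-! ### The bracket of vector fields as a commutator of derivations -/

section Bracket

theorem two_le_infty : (2 : WithTop ℕ∞) ≤ ∞ :=
  WithTop.coe_le_coe.2 (le_top : (2 : ℕ∞) ≤ ⊤)

/-- The derivative of a mapping from a manifold into a normed space, with values in the latter. -/
noncomputable def vectorDeriv (E : Type*) [NormedAddCommGroup E] [NormedSpace ℝ E]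
    {M : Type*} [TopologicalSpace M] [ChartedSpace E M]
    {F : Type*} [NormedAddCommGroup F] [NormedSpace ℝ F] (f : M → F) (p : M) : E →L[ℝ] F :=
  mfderiv 𝓘(ℝ, E) 𝓘(ℝ, F) f p

/-- In the commutator the second derivatives of `f` cancel by symmetry, leaving `Df(DW·V - DV·W)`.
-/
theorem fderiv_apply_lieBracket {E : Type*} [NormedAddCommGroup E] [NormedSpace ℝ E]
    {f : E → ℝ} {V W : E → E} {a b : E → ℝ} {x : E} (hf : ContDiffAt ℝ 2 f x)
    (hV : DifferentiableAt ℝ V x) (hW : DifferentiableAt ℝ W x)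
    (ha : a =ᶠ[𝓝 x] fun u => fderiv ℝ f u (V u)) (hb : b =ᶠ[𝓝 x] fun u => fderiv ℝ f u (W u)) :
    fderiv ℝ f x (VectorField.lieBracket ℝ V W x) =
      fderiv ℝ b x (V x) - fderiv ℝ a x (W x) := by
  have hd : DifferentiableAt ℝ (fderiv ℝ f) x :=
    (hf.fderiv_right (m := 1) (by norm_num)).differentiableAt (by simp)
  have hsymm : IsSymmSndFDerivAt ℝ f x := hf.isSymmSndFDerivAt (by rw [minSmoothness_of_isRCLikeNormedField])
  rw [ha.fderiv_eq, hb.fderiv_eq, fderiv_clm_apply hd hV, fderiv_clm_apply hd hW,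
    VectorField.lieBracket_eq]
  simp [hsymm.eq (V x) (W x)]

variable {E : Type*} [NormedAddCommGroup E] [NormedSpace ℝ E]
  {M : Type*} [TopologicalSpace M] [ChartedSpace E M] [IsManifold 𝓘(ℝ, E) ∞ M]

/-- The pullback inverts the derivative of the inverse chart, and the chain rule applies that
derivative again. -/
theorem fderiv_apply_mpullback_chartAt_symm {f : M → ℝ} {V : Π p : M, TangentSpace 𝓘(ℝ, E) p}
    {p q : M} (hf : MDifferentiableAt 𝓘(ℝ, E) 𝓘(ℝ, ℝ) f q) {u : E}
    (hu : u ∈ (extChartAt 𝓘(ℝ, E) p).target) (hq : (extChartAt 𝓘(ℝ, E) p).symm u = q) :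
    fderiv ℝ (f ∘ (extChartAt 𝓘(ℝ, E) p).symm) u
      (VectorField.mpullbackWithin 𝓘(ℝ, E) 𝓘(ℝ, E) (extChartAt 𝓘(ℝ, E) p).symm V
        (Set.range 𝓘(ℝ, E)) u) = vectorDeriv E f q (V q) := by
  subst hq
  have : IsManifold 𝓘(ℝ, E) 1 M := IsManifold.of_le (n := ∞) (by simp)
  set φ := extChartAt 𝓘(ℝ, E) p
  have hinv := isInvertible_mfderivWithin_extChartAt_symm (I := 𝓘(ℝ, E)) hu
  have hd : MDifferentiableAt 𝓘(ℝ, E) 𝓘(ℝ, E) φ.symm u := by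
    rw [← mdifferentiableWithinAt_univ, ← 𝓘(ℝ, E).range_eq_univ]
    exact mdifferentiableWithinAt_extChartAt_symm hu
  have h1 : fderiv ℝ (f ∘ φ.symm) u =
      (mfderiv 𝓘(ℝ, E) 𝓘(ℝ, ℝ) f (φ.symm u)).comp (mfderiv 𝓘(ℝ, E) 𝓘(ℝ, E) φ.symm u) := by
    rw [← mfderiv_comp u hf hd, mfderiv_eq_fderiv]
  have h2 : mfderivWithin 𝓘(ℝ, E) 𝓘(ℝ, E) φ.symm (Set.range 𝓘(ℝ, E)) u =
      mfderiv 𝓘(ℝ, E) 𝓘(ℝ, E) φ.symm u := by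
    rw [𝓘(ℝ, E).range_eq_univ, mfderivWithin_univ]
  rw [h1, VectorField.mpullbackWithin_apply, h2]
  rw [h2] at hinv
  exact congrArg (mfderiv 𝓘(ℝ, E) 𝓘(ℝ, ℝ) f (φ.symm u)) (hinv.self_apply_inverse _)

theorem vectorDeriv_extChartAt_self (p : M) :
    vectorDeriv E (extChartAt 𝓘(ℝ, E) p) p = ContinuousLinearMap.id ℝ E := by
  have : IsManifold 𝓘(ℝ, E) 1 M := IsManifold.of_le (n := ∞) (by simp)
  have h := hasFDerivAt_comp_chartAt_symm (mdifferentiableAt_extChartAt (I := 𝓘(ℝ, E))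
    (mem_chart_source E p))
  refine h.unique ((hasFDerivAt_id (chartAt E p p)).congr_of_eventuallyEq ?_)
  filter_upwards [(chartAt E p).open_target.mem_nhds (mem_chart_target E p)] with u hu
  exact (chartAt E p).right_inv hu

theorem vectorDeriv_apply_mlieBracket [CompleteSpace E] {f a b : M → ℝ} {V W : Π p : M, TangentSpace 𝓘(ℝ, E) p} {p : M}
    (hf : ContMDiff 𝓘(ℝ, E) 𝓘(ℝ, ℝ) ∞ f)
    (hV : MDifferentiableAt 𝓘(ℝ, E) 𝓘(ℝ, E).tangent
      (fun q => (⟨q, V q⟩ : TangentBundle 𝓘(ℝ, E) M)) p)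
    (hW : MDifferentiableAt 𝓘(ℝ, E) 𝓘(ℝ, E).tangent
      (fun q => (⟨q, W q⟩ : TangentBundle 𝓘(ℝ, E) M)) p)
    (ha : ∀ q, a q = vectorDeriv E f q (V q))
    (hb : ∀ q, b q = vectorDeriv E f q (W q))
    (ha' : MDifferentiableAt 𝓘(ℝ, E) 𝓘(ℝ, ℝ) a p) (hb' : MDifferentiableAt 𝓘(ℝ, E) 𝓘(ℝ, ℝ) b p) :
    vectorDeriv E f p (VectorField.mlieBracket 𝓘(ℝ, E) V W p) =
      vectorDeriv E b p (V p) -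
        vectorDeriv E a p (W p) := by
  have : IsManifold 𝓘(ℝ, E) 2 M := IsManifold.of_le (n := ∞) two_le_infty
  set φ := extChartAt 𝓘(ℝ, E) p
  set V' : E → E := VectorField.mpullbackWithin 𝓘(ℝ, E) 𝓘(ℝ, E) φ.symm V (Set.range 𝓘(ℝ, E))
  set W' : E → E := VectorField.mpullbackWithin 𝓘(ℝ, E) 𝓘(ℝ, E) φ.symm W (Set.range 𝓘(ℝ, E))
  have hdiff : ∀ {U : Π p : M, TangentSpace 𝓘(ℝ, E) p}, MDifferentiableAt 𝓘(ℝ, E) 𝓘(ℝ, E).tangent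
      (fun q => (⟨q, U q⟩ : TangentBundle 𝓘(ℝ, E) M)) p → DifferentiableAt ℝ
        (VectorField.mpullbackWithin 𝓘(ℝ, E) 𝓘(ℝ, E) φ.symm U (Set.range 𝓘(ℝ, E))) (φ p) := by
    intro U hU
    have h := MDifferentiableWithinAt.differentiableWithinAt_mpullbackWithin_vectorField
      (mdifferentiableWithinAt_univ.2 hU)
    have hset : φ.symm ⁻¹' Set.univ ∩ Set.range 𝓘(ℝ, E) = Set.univ := by simp
    rw [hset] at h
    exact differentiableWithinAt_univ.1 h
  have htarget : ∀ᶠ u in 𝓝 (φ p), u ∈ φ.target := extChartAt_target_mem_nhds p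
  have hfd : ∀ q, MDifferentiableAt 𝓘(ℝ, E) 𝓘(ℝ, ℝ) f q := hf.mdifferentiable (by simp)
  have hinv : φ.symm (φ p) = p := extChartAt_to_inv p
  have hΨ : ContDiffAt ℝ 2 (f ∘ φ.symm) (φ p) := by
    have h := (contDiffOn_comp_chartAt_symm hf p).contDiffAt
      ((chartAt E p).open_target.mem_nhds (mem_chart_target E p))
    exact h.of_le two_le_infty
  have key := fderiv_apply_lieBracket (a := a ∘ φ.symm) (b := b ∘ φ.symm) hΨ (hdiff hV) (hdiff hW)
    (htarget.mono fun u hu =>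
      (ha _).trans (fderiv_apply_mpullback_chartAt_symm (hfd _) hu rfl).symm)
    (htarget.mono fun u hu =>
      (hb _).trans (fderiv_apply_mpullback_chartAt_symm (hfd _) hu rfl).symm)
  rw [fderiv_apply_mpullback_chartAt_symm hb' htarget.self_of_nhds hinv,
    fderiv_apply_mpullback_chartAt_symm ha' htarget.self_of_nhds hinv] at key
  refine Eq.trans ?_ key
  -- By definition the manifold bracket is the chart bracket brought back by the inverse derivative
  -- of the chart, which at its own centre is the identity.
  have hbr : VectorField.mlieBracket 𝓘(ℝ, E) V W p =
      (vectorDeriv E φ p : E →L[ℝ] E).inverse (VectorField.lieBracket ℝ V' W' (φ p)) := by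
    have hset : φ.symm ⁻¹' Set.univ ∩ Set.range 𝓘(ℝ, E) = Set.univ := by simp
    rw [← VectorField.lieBracketWithin_univ, ← hset]
    rfl
  have hid : (vectorDeriv E φ p : E →L[ℝ] E).inverse (VectorField.lieBracket ℝ V' W' (φ p)) =
      VectorField.lieBracket ℝ V' W' (φ p) := by
    rw [vectorDeriv_extChartAt_self, ContinuousLinearMap.inverse_id, ContinuousLinearMap.id_apply]
  rw [hbr, hid]
  exact congrArg (fun T : E →L[ℝ] ℝ => T (VectorField.lieBracket ℝ V' W' (φ p)))
    (hasFDerivAt_comp_chartAt_symm (hfd p)).fderiv.symm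

end Bracket

/-! ### Right invariant vector fields -/

section Group

variable {E : Type*} [NormedAddCommGroup E] [NormedSpace ℝ E]
  {G : Type*} [TopologicalSpace G] [ChartedSpace E G] [Group G] [LieGroup 𝓘(ℝ, E) ∞ G]

open Bundle in
-- The field is the tangent map of multiplication applied to `X` at `1` and the zero vector at `g`.
theorem contMDiff_rightInvariantField (X : GroupLieAlgebra 𝓘(ℝ, E) G) :
    ContMDiff 𝓘(ℝ, E) 𝓘(ℝ, E).tangent ∞
      (fun g : G => (⟨g, rightInvariantField X g⟩ : TangentBundle 𝓘(ℝ, E) G)) := by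
  have : IsManifold 𝓘(ℝ, E) ∞ G := inferInstance
  let F₁ : G → (TangentBundle 𝓘(ℝ, E) G × TangentBundle 𝓘(ℝ, E) G) :=
    fun g => (TotalSpace.mk' E 1 X, TotalSpace.mk' E g 0)
  have S₁ : ContMDiff 𝓘(ℝ, E) (𝓘(ℝ, E).tangent.prod 𝓘(ℝ, E).tangent) ∞ F₁ :=
    contMDiff_const.prodMk (contMDiff_zeroSection _ _)
  let F₂ : (TangentBundle 𝓘(ℝ, E) G × TangentBundle 𝓘(ℝ, E) G) →
      TangentBundle (𝓘(ℝ, E).prod 𝓘(ℝ, E)) (G × G) :=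
    (equivTangentBundleProd 𝓘(ℝ, E) G 𝓘(ℝ, E) G).symm
  have S₂ : ContMDiff (𝓘(ℝ, E).tangent.prod 𝓘(ℝ, E).tangent)
    (𝓘(ℝ, E).prod 𝓘(ℝ, E)).tangent ∞ F₂ := contMDiff_equivTangentBundleProd_symm
  let F₃ : TangentBundle (𝓘(ℝ, E).prod 𝓘(ℝ, E)) (G × G) → TangentBundle 𝓘(ℝ, E) G :=
    tangentMap (𝓘(ℝ, E).prod 𝓘(ℝ, E)) 𝓘(ℝ, E) (fun (p : G × G) ↦ p.1 * p.2)
  have S₃ : ContMDiff (𝓘(ℝ, E).prod 𝓘(ℝ, E)).tangent 𝓘(ℝ, E).tangent ∞ F₃ :=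
    ContMDiff.contMDiff_tangentMap (contMDiff_mul 𝓘(ℝ, E) ∞) le_rfl
  have S := (S₃.comp S₂).comp S₁
  convert! S with g
  · simp [F₁, F₂, F₃]
  · simp only [Function.comp_apply, tangentMap, F₃, F₂, F₁]
    rw [mfderiv_prod_eq_add_apply ((contMDiff_mul 𝓘(ℝ, E) ∞).mdifferentiableAt (by simp))]
    exact ((congrArg₂ (· + ·) rfl (map_zero _)).trans (add_zero _)).symm

theorem vectorDeriv_rightInvariantField {F : Type*} [NormedAddCommGroup F] [NormedSpace ℝ F] {f : G → F}
    (hf : MDifferentiable 𝓘(ℝ, E) 𝓘(ℝ, F) f) (X : GroupLieAlgebra 𝓘(ℝ, E) G) (g : G) :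
    vectorDeriv E f g (rightInvariantField X g) =
      vectorDeriv E (fun h => f (h * g)) 1 X := by
  have hg : MDifferentiableAt 𝓘(ℝ, E) 𝓘(ℝ, E) (fun h : G => h * g) 1 :=
    (contMDiff_mul_right (I := 𝓘(ℝ, E)) (n := ∞) (a := g)).mdifferentiable (by simp) 1
  have h := mfderiv_comp_apply (I'' := 𝓘(ℝ, F)) (1 : G) (hf (1 * g)) hg X
  refine Eq.trans ?_ h.symm
  have e : ∀ q : G, q = g → vectorDeriv E f g (rightInvariantField X g) =
      vectorDeriv E f q (rightInvariantField X g) := by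
    rintro q rfl
    rfl
  exact e _ (one_mul g)

end Group

/-! ### Matrix coefficients and the bracket identity -/

section Representation

open SmoothVector

variable {E : Type*} [NormedAddCommGroup E] [NormedSpace ℝ E]
  {G : Type*} [TopologicalSpace G] [ChartedSpace E G] [Group G]
  {H : Type*} [NormedAddCommGroup H] [InnerProductSpace ℂ H]
  {ρ : G →* (H ≃ₗᵢ[ℂ] H)}

theorem contMDiff_imInner_orbit (w : H) (x : SmoothVector E ρ) :
    ContMDiff 𝓘(ℝ, E) 𝓘(ℝ, ℝ) ∞ (fun g : G => imInner w (ρ g (incl x))) :=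
  (imInner w).contMDiff.comp (contMDiff_orbit x)

variable [LieGroup 𝓘(ℝ, E) ∞ G]

theorem vectorDeriv_imInner_orbit (w : H) (X : GroupLieAlgebra 𝓘(ℝ, E) G) (x : SmoothVector E ρ) :
    vectorDeriv E (fun g : G => imInner w (ρ g (incl x))) 1 X =
      imInner w (incl (infinitesimal ρ X x)) := by
  have h := ((imInner w).hasMFDerivAt (x := ρ 1 (incl x))).comp (1 : G)
    (mdifferentiable_orbit x (1 : G)).hasMFDerivAt
  exact congrArg (fun T : E →L[ℝ] ℝ => T X) h.mfderiv

/-- Skewness moves `ρ'(X)` from `ρ(g)x` onto `y`. The result is again a matrix coefficient of `x`,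
hence smooth in `g`, so a second field can be applied. -/
theorem vectorDeriv_imInner_orbit_rightInvariantField (X : GroupLieAlgebra 𝓘(ℝ, E) G)
    (x y : SmoothVector E ρ) (g : G) :
    vectorDeriv E (fun g : G => imInner (incl y) (ρ g (incl x))) g
      (rightInvariantField X g) = -imInner (incl (infinitesimal ρ X y)) (ρ g (incl x)) := by
  rw [vectorDeriv_rightInvariantField ((contMDiff_imInner_orbit _ x).mdifferentiable (by simp))]
  have h := vectorDeriv_imInner_orbit (incl y) X (act ρ g x)
  have e : (fun h : G => imInner (incl y) (ρ (h * g) (incl x))) =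
      fun h : G => imInner (incl y) (ρ h (incl (act ρ g x))) := by
    funext h
    rw [map_mul]
    rfl
  rw [e, h]
  exact omega_infinitesimal X (act ρ g x) y

theorem omega_infinitesimal_rightBracket [CompleteSpace E] (X Y : GroupLieAlgebra 𝓘(ℝ, E) G)
    (x y : SmoothVector E ρ) :
    omega (infinitesimal ρ (rightBracket X Y) x) y =
      omega (infinitesimal ρ Y x) (infinitesimal ρ X y) -
        omega (infinitesimal ρ X x) (infinitesimal ρ Y y) := by
  have : IsManifold 𝓘(ℝ, E) ∞ G := inferInstance
  have hR : ∀ Z : GroupLieAlgebra 𝓘(ℝ, E) G, rightInvariantField Z (1 : G) = Z := fun Z => by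
    have h : ∀ f : G → G, f = id → (show E from mfderiv 𝓘(ℝ, E) 𝓘(ℝ, E) f 1 Z) = Z := by
      rintro _ rfl
      exact congrArg (fun T : E →L[ℝ] E => T Z) (mfderiv_id (I := 𝓘(ℝ, E)) (x := (1 : G)))
    exact h _ (funext mul_one)
  have hd : ∀ Z : GroupLieAlgebra 𝓘(ℝ, E) G, MDifferentiableAt 𝓘(ℝ, E) 𝓘(ℝ, ℝ)
      (fun g : G => imInner (-incl (infinitesimal ρ Z y)) (ρ g (incl x))) 1 := fun Z =>
    (contMDiff_imInner_orbit _ x).mdifferentiable (by simp) 1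
  have hv : ∀ (Z : GroupLieAlgebra 𝓘(ℝ, E) G) (g : G),
      imInner (-incl (infinitesimal ρ Z y)) (ρ g (incl x)) =
        vectorDeriv E (fun g : G => imInner (incl y) (ρ g (incl x))) g
      (rightInvariantField Z g) := fun Z g => by
    rw [vectorDeriv_imInner_orbit_rightInvariantField]
    simp only [imInner_apply, inner_neg_left, Complex.neg_im]
  have key := vectorDeriv_apply_mlieBracket (contMDiff_imInner_orbit (incl y) x)
    ((contMDiff_rightInvariantField X).mdifferentiable (by simp) 1)
    ((contMDiff_rightInvariantField Y).mdifferentiable (by simp) 1) (hv X) (hv Y) (hd X) (hd Y)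
  rw [hR, hR, vectorDeriv_imInner_orbit, vectorDeriv_imInner_orbit, vectorDeriv_imInner_orbit] at key
  refine key.trans ?_
  simp only [omega, imInner_apply, inner_neg_left, Complex.neg_im]
  ring

theorem sigma_rightBracket [CompleteSpace E] (X Y : GroupLieAlgebra 𝓘(ℝ, E) G) :
    sigma ρ (rightBracket X Y) = poisson (sigma ρ X) (sigma ρ Y) := by
  funext x
  -- On the diagonal the two terms of the commutator coincide by antisymmetry of `ω`, and their sum
  -- absorbs the `1/2`.
  rw [poisson, grad_sigma, grad_sigma, sigma, omega_infinitesimal_rightBracket,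
    omega_swap (infinitesimal ρ X x)]
  ring

end Representation

end UnitaryMoment

namespace UnitaryMoment

theorem isLinearMap_sigma {E : Type*} [NormedAddCommGroup E] [NormedSpace ℝ E]
    {G : Type*} [TopologicalSpace G] [ChartedSpace E G] [Group G] [LieGroup 𝓘(ℝ, E) ∞ G]
    {H : Type*} [NormedAddCommGroup H] [InnerProductSpace ℂ H] (ρ : G →* (H ≃ₗᵢ[ℂ] H)) :
    IsLinearMap ℝ (fun X : GroupLieAlgebra 𝓘(ℝ, E) G => sigma ρ X) where
  map_add X Y := by
    funext x
    simp only [sigma, infinitesimal_add_left, omega_add_left, Pi.add_apply]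
    ring
  map_smul r X := by
    funext x
    simp only [sigma, infinitesimal_smul_left, omega_smul_left, Pi.smul_apply, smul_eq_mul]
    ring

end UnitaryMoment

theorem lemma2p11 {E : Type*} [NormedAddCommGroup E] [NormedSpace ℝ E] [FiniteDimensional ℝ E]
    {G : Type*} [TopologicalSpace G] [SecondCountableTopology G] [ChartedSpace E G] [Group G]
    [LieGroup 𝓘(ℝ, E) ∞ G]
    {H : Type*} [NormedAddCommGroup H] [InnerProductSpace ℂ H] [CompleteSpace H]
    (ρ : G →* (H ≃ₗᵢ[ℂ] H)) (_hρ : ∀ x : H, Continuous fun g : G => ρ g x) :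
    -- `σ` takes values in `C^∞_*(H_∞, ℝ)`
    (∀ X : GroupLieAlgebra 𝓘(ℝ, E) G, UnitaryMoment.sigma ρ X ∈ UnitaryMoment.smoothStar ρ) ∧
    -- `σ` is a Lie algebra homomorphism
    IsLinearMap ℝ (fun X : GroupLieAlgebra 𝓘(ℝ, E) G => UnitaryMoment.sigma ρ X) ∧
    (∀ X Y : GroupLieAlgebra 𝓘(ℝ, E) G,
      UnitaryMoment.sigma ρ (UnitaryMoment.rightBracket X Y) =
        UnitaryMoment.poisson (UnitaryMoment.sigma ρ X) (UnitaryMoment.sigma ρ Y)) ∧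
    -- `grad ∘ σ = ρ'`
    (∀ X : GroupLieAlgebra 𝓘(ℝ, E) G,
      UnitaryMoment.grad (UnitaryMoment.sigma ρ X) = UnitaryMoment.infinitesimal ρ X) ∧
    -- equivariance: `σ(X) ∘ ρ(g) = σ(Ad(g⁻¹)X)`
    (∀ (g : G) (X : GroupLieAlgebra 𝓘(ℝ, E) G),
      UnitaryMoment.sigma ρ X ∘ UnitaryMoment.act ρ g =
        UnitaryMoment.sigma ρ (UnitaryMoment.Ad g⁻¹ X)) := by
  -- The bracket identity requires a complete model space.
  have : CompleteSpace E := FiniteDimensional.complete ℝ E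
  exact ⟨UnitaryMoment.sigma_mem_smoothStar, UnitaryMoment.isLinearMap_sigma ρ,
    UnitaryMoment.sigma_rightBracket, UnitaryMoment.grad_sigma, UnitaryMoment.sigma_comp_act⟩
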